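/- Let $G$ be a real, connected, compact Lie group with semisimple Lie algebra $\mathfrak g=T_eG$, and let $\mathcal X$ be a linear vector field on $G$, that is, a smooth vector field whose flow $(\varphi_t)_{t\in\mathbb R}$ consists of Lie group automorphisms of $G$. Let $\mathcal D:\mathfrak g\to\mathfrak g$, $\mathcal D(Y)=-[\mathcal X,Y]$ (where $Y \in \mathfrak g$ is identified with the left invariant vector field it determines) be the associated derivation. Then there is a right invariant vector field $X$ on $G$ with $\mathcal X = X + I_*X$, where $I_*$ is the differential of the inversion $g\mapsto g^{-1}$. Moreover, for every such $X$ (identified with its value in $T_eG$), the following are equivalent: 1. for every $g\in G$ the orbit $t\mapsto \exp(tX)\,g$ of the invariant flow is periodic; 2. $e$ is a periodic point of the invariant flow, i.e. $t\mapsto\exp(tX)\,e$ is periodic; 3. every $g\in G$ is a periodic point of the linear flow, i.e. $t\mapsto\varphi_t(g)$ is periodic; 4. for every $g\in G$, $\mathrm{Ad}(g)$ is a periodic point of the flow $e^{t\mathcal D}$, i.e. $t\mapsto e^{t\mathcal D}\circ \mathrm{Ad}(g)$ is periodic. Here a curve $\gamma:\mathbb R\to M$ is called periodic if there is $s>0$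 with $\gamma(t+s)=\gamma(t)$ for all $t\in\mathbb R$; constant curves are periodic, and in 1, 3 and 4 the period may depend on $g$. -/

import Mathlib

open scoped Manifold ContDiff

noncomputable section

namespace LinearFlow

section Curves

/-- A curve `γ : ℝ → α` is periodic: for some `s > 0`, `γ (t + s) = γ t` for all `t`.
Constant curves are periodic. -/
def IsPeriodicCurve {α : Type*} (γ : ℝ → α) : Prop :=
  ∃ s : ℝ, 0 < s ∧ ∀ t : ℝ, γ (t + s) = γ t

end Curves

section Operators

variable {E : Type*} [NormedAddCommGroup E] [NormedSpace ℝ E] [FiniteDimensional ℝ E]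

/-- The operator `e ^ (t A)`, for an endomorphism `A` of a finite-dimensional real vector space. -/
def operatorExpFlow (A : E →ₗ[ℝ] E) (t : ℝ) : E →L[ℝ] E :=
  NormedSpace.exp (t • LinearMap.toContinuousLinearMap A)

end Operators

section LieGroups

variable {E : Type*} [NormedAddCommGroup E] [NormedSpace ℝ E] {H : Type*} [TopologicalSpace H]
  (I : ModelWithCorners ℝ E H) {G : Type*} [TopologicalSpace G] [ChartedSpace H G]

/-- `φ` is the (global) flow of the vector field `V`: for every `g`, the curve `t ↦ φ t g` is an
integral curve of `V` that starts at `g`. -/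
def IsFlowOf (φ : ℝ → G → G) (V : ∀ g : G, TangentSpace I g) : Prop :=
  ∀ g : G, φ 0 g = g ∧ IsMIntegralCurve (I := I) (fun t ↦ φ t g) V

/-- The vector field `V` is smooth, as a section of the tangent bundle. -/
def IsSmoothField [IsManifold I 1 G] (V : ∀ g : G, TangentSpace I g) : Prop :=
  ContMDiff I I.tangent ∞ (fun g ↦ (⟨g, V g⟩ : TangentBundle I G))

variable [Group G]

/-- `f : G → G` is an automorphism of the Lie group `G`: a group automorphism that is smooth
together with its inverse. -/
def IsLieGroupAutomorphism (f : G → G) : Prop :=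
  ∃ e : G ≃* G, (∀ g, e g = f g) ∧ ContMDiff I I ∞ e ∧ ContMDiff I I ∞ e.symm

/-- A linear vector field on a Lie group: a smooth vector field that has a global flow consisting
of automorphisms of the Lie group. -/
def IsLinearVectorField [IsManifold I 1 G] (V : ∀ g : G, TangentSpace I g) : Prop :=
  IsSmoothField I V ∧ ∃ φ : ℝ → G → G, IsFlowOf I φ V ∧ ∀ t, IsLieGroupAutomorphism I (φ t)

variable {I}

/-- The right invariant vector field with value `X` at the identity: `g ↦ d(R_g)_e X`, where
`R_g x = x * g`. -/
def rightInvariantField (X : GroupLieAlgebra I G) (g : G) : TangentSpace I g :=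
  mfderiv I I (fun x : G ↦ x * g) (1 : G) X

/-- The vector field `I_* V`, the image of `V` under the differential of the inversion
`x ↦ x⁻¹`: its value at `g` is the image of `V (g⁻¹)` under the differential at `g⁻¹`. -/
def invPushforward (V : ∀ g : G, TangentSpace I g) (g : G) : TangentSpace I g :=
  mfderiv I I (fun x : G ↦ x⁻¹) g⁻¹ (V g⁻¹)

open Classical in
/-- The exponential map of a Lie group: `exp X` is the value at time `1` of the integral curve
through the identity of the invariant vector field determined by `X`. (This curve exists and is
unique on every Lie group; the alternative value `1` is never used there.) -/
def lieExp (X : GroupLieAlgebra I G) : G :=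
  if h : ∃ γ : ℝ → G, γ 0 = 1 ∧ IsMIntegralCurve (I := I) γ (rightInvariantField X)
  then h.choose 1 else 1

/-- The adjoint representation: `Ad g` is the differential at the identity of the conjugation
`x ↦ g * x * g⁻¹`. -/
def Ad (g : G) : GroupLieAlgebra I G →L[ℝ] GroupLieAlgebra I G :=
  mfderiv I I (fun x : G ↦ g * x * g⁻¹) (1 : G)

instance instLieGroupMinSmoothness [LieGroup I ∞ G] : LieGroup I (minSmoothness ℝ 3) G :=
  LieGroup.of_le (n := ∞) (by
    rw [minSmoothness_of_isRCLikeNormedField]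
    exact ENat.LEInfty.out)

instance instIsManifoldOne [LieGroup I ∞ G] : IsManifold I 1 G :=
  IsManifold.of_le (n := ∞) ENat.LEInfty.out

variable [CompleteSpace E] [LieGroup I ∞ G]

/-- The endomorphism `D` of the Lie algebra given by `D Y = -[V, Y]`, where `Y` is identified with
the left invariant vector field that it determines. -/
def derivationOf (V : ∀ g : G, TangentSpace I g) :
    GroupLieAlgebra I G →ₗ[ℝ] GroupLieAlgebra I G where
  toFun Y := - VectorField.mlieBracket I V (mulInvariantVectorField Y) (1 : G)
  map_add' Y Z := by
    rw [mulInvariantVectorField_add, VectorField.mlieBracket_add_right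
      (mdifferentiableAt_mulInvariantVectorField _) (mdifferentiableAt_mulInvariantVectorField _),
      neg_add]
  map_smul' c Y := by
    rw [mulInvariantVectorField_smul, VectorField.mlieBracket_const_smul_right
      (mdifferentiableAt_mulInvariantVectorField _), smul_neg, RingHom.id_apply]

/-- The linear flow `e ^ (t D)` on the Lie algebra, which as a vector space is the model space `E`
(a tangent space is by definition a copy of `E`). -/
def expFlow [FiniteDimensional ℝ E] (D : GroupLieAlgebra I G →ₗ[ℝ] GroupLieAlgebra I G) (t : ℝ) :
    GroupLieAlgebra I G →L[ℝ] GroupLieAlgebra I G :=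
  operatorExpFlow (E := E) D t

end LieGroups

end LinearFlow

end

/-!
Let `γ` be the one-parameter group `t ↦ exp (t X)`. When `𝒳 = X + I_* X`, the linear flow is
`φ_t(g) = γ(t) g γ(t)⁻¹`, and `e^{t𝒟} = Ad (γ t)`. So a period of `γ` is a period of every orbit of
all three flows, and two implications remain.

* If `Ad ∘ γ` is periodic, some `γ(s)` lies in the kernel of `Ad`, a closed subgroup that is
  discrete because `ad` is injective, hence finite; a power `γ(ns)` is then trivial.
* If every orbit of the linear flow is periodic, `G` is covered by the centralizers of the `γ(s)`
  with `s > 0`. The centralizer of `(e^{s𝒟} - 1) / s` always contains that of `𝒟`, and by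
  analyticity in `s` it is larger for only countably many `s`. So countably many centralizers,
  together with the closed subgroup of those `g` for which `Ad g` commutes with `𝒟`, cover `G`; by
  Baire one of them is open, and hence all of `G`. Therefore either `𝒟` commutes with `Ad G`, which
  forces `X = 0`, or some `γ(s)` is central.

The vector `X` exists because `g ↦ (d R_{g⁻¹}) 𝒳(g)` is a cocycle for `Ad`; averaging it over Haar
measure writes it as the coboundary `g ↦ X - Ad(g) X`.
-/

open Set Filter Topology MeasureTheory

namespace LinearFlow

section AnalyticFamilies

variable {V W : Type*} [NormedAddCommGroup V] [NormedSpace ℝ V] [FiniteDimensional ℝ V]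
  [NormedAddCommGroup W] [NormedSpace ℝ W] [FiniteDimensional ℝ W]

theorem analyticAt_det (A : V →L[ℝ] V) :
    AnalyticAt ℝ (fun B : V →L[ℝ] V ↦ LinearMap.det (B : V →ₗ[ℝ] V)) A := by
  let b := Module.finBasis ℝ V
  have hentry : ∀ i j, AnalyticAt ℝ
      (fun B : V →L[ℝ] V ↦ LinearMap.toMatrix b b (B : V →ₗ[ℝ] V) i j) A := fun i j ↦
    (((LinearMap.toContinuousLinearMap (b.coord i)).comp
      (ContinuousLinearMap.apply ℝ V (b j))).analyticAt A).congr
      (Eventually.of_forall fun B ↦ by simp [LinearMap.toMatrix_apply])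
  simp only [← LinearMap.det_toMatrix b, Matrix.det_apply']
  exact Finset.analyticAt_fun_sum _ fun σ _ ↦
    analyticAt_const.mul (Finset.analyticAt_fun_prod _ fun i _ ↦ hentry _ _)

theorem countable_setOf_eq_zero_of_analytic {f : ℝ → ℝ} (hf : AnalyticOnNhd ℝ f univ) {s₀ : ℝ}
    (h₀ : f s₀ ≠ 0) : {s | f s = 0}.Countable := by
  have h := (mem_codiscrete'.1 (hf.preimage_zero_mem_codiscrete h₀)).2
  rw [← preimage_compl, compl_compl] at h
  exact (HereditarilyLindelofSpace.isLindelof _).countable_of_isDiscrete h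

theorem exists_comp_comp_eq_self (A : V →L[ℝ] W) : ∃ g : W →L[ℝ] V, ∀ v, A (g (A v)) = A v := by
  obtain ⟨h, hh⟩ := (A : V →ₗ[ℝ] W).rangeRestrict.exists_rightInverse_of_surjective
    (LinearMap.range_rangeRestrict _)
  obtain ⟨g, hg⟩ := h.exists_extend
  refine ⟨LinearMap.toContinuousLinearMap g, fun v ↦ ?_⟩
  have hgv : g (A v) = h ((A : V →ₗ[ℝ] W).rangeRestrict v) :=
    LinearMap.congr_fun hg ((A : V →ₗ[ℝ] W).rangeRestrict v)
  exact (congrArg A hgv).trans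
    (congrArg Subtype.val (LinearMap.congr_fun hh ((A : V →ₗ[ℝ] W).rangeRestrict v)))

/- With `g` a generalized inverse of `D s₀`, the kernel of `D s` is that of `D s₀` as soon as
`1 + g ∘ (D s - D s₀)`, which is the identity at `s₀`, is invertible. -/
theorem countable_setOf_not_ker_le {D : ℝ → V →L[ℝ] W} (hD : AnalyticOnNhd ℝ D univ) {s₀ : ℝ}
    (hker : ∀ s v, D s₀ v = 0 → D s v = 0) : {s | ∃ v, D s v = 0 ∧ D s₀ v ≠ 0}.Countable := by
  obtain ⟨g, hg⟩ := exists_comp_comp_eq_self (D s₀)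
  let P : ℝ → V →L[ℝ] V := fun s ↦ 1 + g.comp (D s - D s₀)
  have hP : AnalyticOnNhd ℝ P univ := fun s hs ↦ analyticAt_const.add
    ((ContinuousLinearMap.analyticAt (ContinuousLinearMap.compL ℝ V W V g) _).comp
      ((hD s hs).sub analyticAt_const))
  have hdet : AnalyticOnNhd ℝ (fun s ↦ LinearMap.det (P s : V →ₗ[ℝ] V)) univ := fun s hs ↦
    (analyticAt_det (P s)).comp (hP s hs)
  have hdet₀ : LinearMap.det (P s₀ : V →ₗ[ℝ] V) ≠ 0 := by simp [P]
  refine (countable_setOf_eq_zero_of_analytic hdet hdet₀).mono fun s ⟨v, hv, hv₀⟩ ↦ ?_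
  by_contra hs
  have hinj : Function.Injective (P s) :=
    (LinearMap.equivOfDetNeZero (P s : V →ₗ[ℝ] V) hs).injective
  set w := v - g (D s₀ v) with hw
  have hw₀ : D s₀ w = 0 := by rw [hw, map_sub, hg, sub_self]
  have hPv : P s v = w := by simp [P, hv, hw, sub_eq_add_neg]
  have hPw : P s w = w := by simp [P, hw₀, hker s w hw₀]
  exact hv₀ (hinj (hPv.trans hPw.symm) ▸ hw₀)

end AnalyticFamilies

section OneParameterGroups

variable {A : Type*} [NormedRing A] [NormedAlgebra ℝ A]

theorem eq_exp_of_hasDerivAt [CompleteSpace A] {a : ℝ → A} {d : A} (h0 : a 0 = 1)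
    (hadd : ∀ s t, a (s + t) = a s * a t) (hd : HasDerivAt a d 0) (t : ℝ) :
    a t = NormedSpace.exp (t • d) := by
  let : NormedAlgebra ℚ A := NormedAlgebra.restrictScalars ℚ ℝ A
  have ha (t : ℝ) : HasDerivAt a (a t * d) t := by
    have h : HasDerivAt (fun x ↦ a t * a (x - t)) (a t * d) t :=
      (HasDerivAt.comp_sub_const t t (by simpa using hd)).const_mul (a t)
    simpa only [← hadd, add_sub_cancel] using h
  have hquot (t : ℝ) : HasDerivAt (fun x ↦ a x * NormedSpace.exp (x • -d)) 0 t := by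
    convert (ha t).mul (hasDerivAt_exp_smul_const' (𝕂 := ℝ) (-d) t) using 1
    · rfl
    · rw [mul_assoc, neg_mul, mul_neg, add_neg_cancel]
  have hconst : a t * NormedSpace.exp (t • -d) = 1 := by
    simpa [h0] using is_const_of_deriv_eq_zero (fun t ↦ (hquot t).differentiableAt)
      (fun t ↦ (hquot t).deriv) t 0
  have hinv : NormedSpace.exp (t • -d) * NormedSpace.exp (t • d) = 1 := by
    rw [smul_neg, ← NormedSpace.exp_add_of_commute (Commute.refl (t • d)).neg_left,
      neg_add_cancel, NormedSpace.exp_zero]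
  rw [← mul_one (a t), ← hinv, ← mul_assoc, hconst, one_mul]

theorem analyticAt_dslope_exp_smul [CompleteSpace A] (d : A) (s : ℝ) :
    AnalyticAt ℝ (dslope (fun t : ℝ ↦ NormedSpace.exp (t • d)) 0) s := by
  have hexp (t : ℝ) : AnalyticAt ℝ (fun t : ℝ ↦ NormedSpace.exp (t • d)) t :=
    (NormedSpace.exp_analytic (𝕂 := ℝ) (t • d)).comp
      (f := fun t : ℝ ↦ t • d) (analyticAt_id.smul analyticAt_const)
  rcases eq_or_ne s 0 with rfl | hs
  · obtain ⟨p, hp⟩ := hexp 0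
    exact ⟨_, hp.has_fpower_series_dslope_fslope⟩
  · refine AnalyticAt.congr ?_ (dslope_eventuallyEq_slope_of_ne _ hs).symm
    exact ((analyticAt_id.sub analyticAt_const).inv (sub_ne_zero.2 hs)).smul
      ((hexp s).sub analyticAt_const)

theorem countable_setOf_commute_exp_smul [FiniteDimensional ℝ A] (d : A) :
    {s : ℝ | ∃ m, Commute (NormedSpace.exp (s • d)) m ∧ ¬Commute d m}.Countable := by
  have : CompleteSpace A := FiniteDimensional.complete ℝ A
  set q := dslope (fun t : ℝ ↦ NormedSpace.exp (t • d)) 0 with hq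
  have hq₀ : q 0 = d := by
    simpa [hq] using (hasDerivAt_exp_smul_const (𝕂 := ℝ) d 0).deriv
  have hqs {s : ℝ} (hs : s ≠ 0) : q s = s⁻¹ • (NormedSpace.exp (s • d) - 1) := by
    simp [hq, dslope_of_ne _ hs, slope_def_module]
  have hcomm {s : ℝ} {m : A} (h : Commute (NormedSpace.exp (s • d)) m) (hs : s ≠ 0) :
      Commute (q s) m := by
    rw [hqs hs]
    exact (h.sub_left (Commute.one_left m)).smul_left _
  let c : A →L[ℝ] A →L[ℝ] A := ContinuousLinearMap.mul ℝ A - (ContinuousLinearMap.mul ℝ A).flip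
  have hc {x m : A} : c x m = 0 ↔ Commute x m := sub_eq_zero
  have hanalytic : AnalyticOnNhd ℝ (fun s ↦ c (q s)) univ := fun s _ ↦
    (c.analyticAt _).comp (analyticAt_dslope_exp_smul d s)
  have hker (s : ℝ) (m : A) (h : c (q 0) m = 0) : c (q s) m = 0 := by
    rcases eq_or_ne s 0 with rfl | hs
    · exact h
    · rw [hc, hq₀] at h
      exact hc.2 (hcomm (h.smul_left s).exp_left hs)
  refine ((countable_singleton 0).union (countable_setOf_not_ker_le hanalytic hker)).mono ?_
  rintro s ⟨m, hm, hdm⟩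
  refine or_iff_not_imp_left.2 fun hs ↦ ⟨m, hc.2 (hcomm hm hs), ?_⟩
  rwa [Ne, hc, hq₀]

end OneParameterGroups

section MixedDerivatives

variable {E E' F : Type*} [NormedAddCommGroup E] [NormedSpace ℝ E] [NormedAddCommGroup E']
  [NormedSpace ℝ E'] [NormedAddCommGroup F] [NormedSpace ℝ F]

/-- The mixed second derivative of a function of two variables: `mixedFDeriv f p u v` is the second
derivative of `f` at `p` in the direction `u` of the first and `v` of the second variable. -/
noncomputable def mixedFDeriv (f : E × E' → F) (p : E × E') : E →L[ℝ] E' →L[ℝ] F :=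
  (fderiv ℝ (fderiv ℝ f) p).bilinearComp (.inl ℝ E E') (.inr ℝ E E')

variable {f : E × E' → F} {u₀ : E} {v₀ : E'}

theorem hasFDerivAt_fderiv_of_contDiffAt {p : E × E'} (hf : ContDiffAt ℝ ∞ f p) :
    HasFDerivAt (fderiv ℝ f) (fderiv ℝ (fderiv ℝ f) p) p :=
  ((hf.fderiv_right (m := 1) (by rw [one_add_one_eq_two]; exact ENat.LEInfty.out)).differentiableAt
    one_ne_zero).hasFDerivAt

theorem eventually_differentiableAt_of_contDiffAt {p : E × E'} (hf : ContDiffAt ℝ ∞ f p) :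
    ∀ᶠ q in 𝓝 p, DifferentiableAt ℝ f q :=
  ((hf.of_le (m := 1) ENat.LEInfty.out).eventually (by simp)).mono fun _ hq ↦
    hq.differentiableAt one_ne_zero

theorem hasFDerivAt_fderiv_snd (hf : ContDiffAt ℝ ∞ f (u₀, v₀)) :
    HasFDerivAt (fun u ↦ fderiv ℝ (fun v ↦ f (u, v)) v₀) (mixedFDeriv f (u₀, v₀)) u₀ := by
  have hpartial : ∀ᶠ u in 𝓝 u₀, fderiv ℝ (fun v ↦ f (u, v)) v₀ =
      (fderiv ℝ f (u, v₀)).comp (.inr ℝ E E') := by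
    have hcont : ContinuousAt (fun u : E ↦ (u, v₀)) u₀ := by fun_prop
    filter_upwards [hcont.eventually (eventually_differentiableAt_of_contDiffAt hf)] with u hu
    exact (hu.hasFDerivAt.comp v₀ (hasFDerivAt_prodMk_right u v₀)).fderiv
  let restrict : (E × E' →L[ℝ] F) →L[ℝ] (E' →L[ℝ] F) :=
    (ContinuousLinearMap.compL ℝ E' (E × E') F).flip (.inr ℝ E E')
  have h := restrict.hasFDerivAt.comp u₀ (HasFDerivAt.comp (g := fderiv ℝ f) u₀
    (hasFDerivAt_fderiv_of_contDiffAt hf) (hasFDerivAt_prodMk_left u₀ v₀))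
  exact h.congr_of_eventuallyEq hpartial

theorem hasFDerivAt_fderiv_fst_apply (hf : ContDiffAt ℝ ∞ f (u₀, v₀)) (Z : E) :
    HasFDerivAt (fun v ↦ fderiv ℝ (fun u ↦ f (u, v)) u₀ Z) (mixedFDeriv f (u₀, v₀) Z) v₀ := by
  have hpartial : ∀ᶠ v in 𝓝 v₀, fderiv ℝ (fun u ↦ f (u, v)) u₀ Z = fderiv ℝ f (u₀, v) (Z, 0) := by
    have hcont : ContinuousAt (fun v : E' ↦ (u₀, v)) v₀ := by fun_prop
    filter_upwards [hcont.eventually (eventually_differentiableAt_of_contDiffAt hf)] with v hv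
    exact congrArg (fun L : E →L[ℝ] F ↦ L Z)
      (hv.hasFDerivAt.comp u₀ (hasFDerivAt_prodMk_left u₀ v)).fderiv
  have hsymm : IsSymmSndFDerivAt ℝ f (u₀, v₀) := hf.isSymmSndFDerivAt (by
    rw [minSmoothness_of_isRCLikeNormedField]; exact ENat.LEInfty.out)
  have h := ((HasFDerivAt.comp (g := fderiv ℝ f) v₀ (hasFDerivAt_fderiv_of_contDiffAt hf)
    (hasFDerivAt_prodMk_right u₀ v₀)).clm_apply
    (hasFDerivAt_const ((Z, 0) : E × E') v₀)).congr_of_eventuallyEq hpartial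
  convert h using 1
  ext Y
  simpa [mixedFDeriv] using hsymm (Z, 0) (0, Y)

end MixedDerivatives

section TangentMaps

variable {E : Type*} [NormedAddCommGroup E] [NormedSpace ℝ E] {H : Type*} [TopologicalSpace H]
  {I : ModelWithCorners ℝ E H} {M : Type*} [TopologicalSpace M] [ChartedSpace H M]
  {E' : Type*} [NormedAddCommGroup E'] [NormedSpace ℝ E'] {H' : Type*} [TopologicalSpace H']
  {I' : ModelWithCorners ℝ E' H'} {M' : Type*} [TopologicalSpace M'] [ChartedSpace H' M']
  {E'' : Type*} [NormedAddCommGroup E''] [NormedSpace ℝ E''] {H'' : Type*} [TopologicalSpace H'']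
  {I'' : ModelWithCorners ℝ E'' H''} {M'' : Type*} [TopologicalSpace M''] [ChartedSpace H'' M'']

variable (I I') in
/-- The differential of `f` at `x` as a map between the model spaces. Forgetting the base points of
the tangent spaces allows differentials at different points to be compared and multiplied. -/
noncomputable def tderiv (f : M → M') (x : M) : E →L[ℝ] E' := mfderiv I I' f x

theorem tderiv_id (x : M) : tderiv I I (fun y : M ↦ y) x = ContinuousLinearMap.id ℝ E :=
  mfderiv_id

theorem tderiv_const (c : M') (x : M) : tderiv I I' (fun _ : M ↦ c) x = 0 :=
  mfderiv_const

theorem tderiv_comp {g : M' → M''} {f : M → M'} {x : M} {y : M'} (hg : MDifferentiableAt I' I'' g y)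
    (hf : MDifferentiableAt I I' f x) (hy : f x = y) :
    tderiv I I'' (fun z ↦ g (f z)) x = (tderiv I' I'' g y).comp (tderiv I I' f x) := by
  subst hy
  exact mfderiv_comp x hg hf

theorem tderiv_comp_apply {g : M' → M''} {f : M → M'} {x : M} {y : M'}
    (hg : MDifferentiableAt I' I'' g y) (hf : MDifferentiableAt I I' f x) (hy : f x = y) (v : E) :
    tderiv I I'' (fun z ↦ g (f z)) x v = tderiv I' I'' g y (tderiv I I' f x v) :=
  congrArg (fun L : E →L[ℝ] E'' ↦ L v) (tderiv_comp hg hf hy)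

theorem hasMFDerivAt_tderiv {f : M → M'} {x : M} (hf : MDifferentiableAt I I' f x) :
    HasMFDerivAt I I' f x (tderiv (E := E) (E' := E') I I' f x) :=
  hf.hasMFDerivAt

theorem tderiv_eq_of_hasMFDerivAt {f : M → M'} {x : M} {L : E →L[ℝ] E'}
    (hf : HasMFDerivAt I I' f x L) : tderiv I I' f x = L :=
  hf.mfderiv

/-- The curve `γ` is differentiable at `t`, with velocity `v`. -/
def HasVelocityAt (I : ModelWithCorners ℝ E H) (γ : ℝ → M) (t : ℝ) (v : E) : Prop :=
  HasMFDerivAt 𝓘(ℝ, ℝ) I γ t (ContinuousLinearMap.toSpanSingleton ℝ v : ℝ →L[ℝ] E)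

theorem HasVelocityAt.comp {γ : ℝ → M} {t : ℝ} {v : E} (hγ : HasVelocityAt I γ t v)
    {f : M → M'} {x : M} (hf : MDifferentiableAt I I' f x) (hx : γ t = x) :
    HasVelocityAt I' (fun s ↦ f (γ s)) t (tderiv I I' f x v) := by
  subst hx
  rw [HasVelocityAt, ← ContinuousLinearMap.comp_toSpanSingleton]
  exact HasMFDerivAt.comp t (hasMFDerivAt_tderiv hf) hγ

theorem HasVelocityAt.unique {γ : ℝ → M} {t : ℝ} {v w : E} (hv : HasVelocityAt I γ t v)
    (hw : HasVelocityAt I γ t w) : v = w := by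
  have h : ContinuousLinearMap.toSpanSingleton ℝ v = ContinuousLinearMap.toSpanSingleton ℝ w :=
    hasMFDerivAt_unique hv hw
  simpa using congrArg (fun L : ℝ →L[ℝ] E ↦ L 1) h

theorem HasVelocityAt.hasDerivAt {γ : ℝ → E} {t : ℝ} {v : E} (h : HasVelocityAt 𝓘(ℝ, E) γ t v) :
    HasDerivAt γ v t :=
  hasMFDerivAt_iff_hasFDerivAt.1 h

theorem tderiv_prodMk {f : M → M'} {h : M → M''} {x : M} (hf : MDifferentiableAt I I' f x)
    (hh : MDifferentiableAt I I'' h x) :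
    tderiv I (I'.prod I'') (fun y ↦ (f y, h y)) x = (tderiv I I' f x).prod (tderiv I I'' h x) :=
  hf.mfderiv_prod hh

theorem HasVelocityAt.prodMk {γ : ℝ → M} {η : ℝ → M'} {t : ℝ} {v : E} {w : E'}
    (hγ : HasVelocityAt I γ t v) (hη : HasVelocityAt I' η t w) :
    HasVelocityAt (I.prod I') (fun s ↦ (γ s, η s)) t (v, w) :=
  HasMFDerivAt.prodMk hγ hη

theorem mdifferentiableAt_of_smooth {f : M → M'} (hf : ContMDiff I I' ∞ f) {x : M} :
    MDifferentiableAt I I' f x :=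
  hf.mdifferentiableAt (by simp)

theorem totalSpace_mk_congr {x y : M} (hxy : x = y) {v w : E} (hvw : v = w) :
    (⟨x, v⟩ : TangentBundle I M) = ⟨y, w⟩ := by
  subst hxy hvw; rfl

end TangentMaps

section Charts

variable {E : Type*} [NormedAddCommGroup E] [NormedSpace ℝ E] {H : Type*} [TopologicalSpace H]
  {I : ModelWithCorners ℝ E H} {M : Type*} [TopologicalSpace M] [ChartedSpace H M]
  {F : Type*} [NormedAddCommGroup F] [NormedSpace ℝ F] {x₀ : M}

/-- A vector field read in the preferred chart at `x₀`. -/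
noncomputable def chartField (x₀ : M) (V : ∀ x : M, TangentSpace I x) (u : E) : E :=
  tderiv I 𝓘(ℝ, E) (extChartAt I x₀) ((extChartAt I x₀).symm u) (V ((extChartAt I x₀).symm u))

variable (I) in
/-- A map `M × M → M` read in the preferred chart at `x₀`. -/
noncomputable def inChart (x₀ : M) (Φ : M × M → M) (p : E × E) : E :=
  extChartAt I x₀ (Φ ((extChartAt I x₀).symm p.1, (extChartAt I x₀).symm p.2))

variable (I) in
/-- The mixed second derivative at `(x₀, x₀)` of a map `M × M → M`, computed in the preferred chart
at `x₀`. -/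
noncomputable def chartMixedDeriv (x₀ : M) (Φ : M × M → M) : E →L[ℝ] E →L[ℝ] E :=
  mixedFDeriv (inChart I x₀ Φ) (extChartAt I x₀ x₀, extChartAt I x₀ x₀)

theorem hasFDerivAt_chartField_add {V W : ∀ x : M, TangentSpace I x} {A B : E →L[ℝ] E} {u : E}
    (hV : HasFDerivAt (chartField (E := E) x₀ V) A u)
    (hW : HasFDerivAt (chartField (E := E) x₀ W) B u) :
    HasFDerivAt (chartField (E := E) x₀ fun x ↦ V x + W x) (A + B) u :=
  (hV.add hW).congr_of_eventuallyEq <| Eventually.of_forall fun _ ↦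
    map_add (tderiv (E := E) I 𝓘(ℝ, E) (extChartAt I x₀) _) _ _

theorem eventually_symm_mem_source [I.Boundaryless] (x₀ : M) :
    ∀ᶠ u in 𝓝 (extChartAt I x₀ x₀), (extChartAt I x₀).symm u ∈ (extChartAt I x₀).source := by
  filter_upwards [extChartAt_target_mem_nhds (I := I) x₀] with u hu
  exact (extChartAt I x₀).map_target hu

theorem eventually_ne_of_hasMFDerivAt [FiniteDimensional ℝ E] [I.Boundaryless] {f : M → F}
    {L : E →L[ℝ] F} (hf : HasMFDerivAt I 𝓘(ℝ, F) f x₀ L) (hL : Function.Injective L) :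
    ∀ᶠ x in 𝓝[≠] x₀, f x ≠ f x₀ := by
  have hL' : ∃ C, AntilipschitzWith C L := by
    obtain ⟨C, -, hC⟩ := LinearMap.exists_antilipschitzWith (L : E →ₗ[ℝ] F)
      (LinearMap.ker_eq_bot.2 hL)
    exact ⟨C, hC⟩
  have hfu : HasFDerivAt (fun u ↦ f ((extChartAt I x₀).symm u)) L (extChartAt I x₀ x₀) :=
    HasFDerivWithinAt.hasFDerivAt hf.2 (by rw [I.range_eq_univ]; exact univ_mem)
  have hne := hfu.eventually_ne (c := f x₀) hL'
  rw [eventually_nhdsWithin_iff] at hne ⊢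
  filter_upwards [extChartAt_source_mem_nhds (I := I) x₀,
    (continuousAt_extChartAt (I := I) x₀).eventually hne] with x hx hxne hxx₀
  rw [(extChartAt I x₀).left_inv hx] at hxne
  exact hxne fun h ↦ hxx₀ ((extChartAt I x₀).injOn hx (mem_extChartAt_source x₀) h)

variable [IsManifold I 1 M]

theorem tderiv_extChartAt_self (x₀ : M) :
    tderiv I 𝓘(ℝ, E) (extChartAt I x₀) x₀ = ContinuousLinearMap.id ℝ E :=
  mfderiv_extChartAt_self

theorem hasMFDerivAt_extChartAt_self (x₀ : M) :
    HasMFDerivAt I 𝓘(ℝ, E) (extChartAt I x₀) x₀ (ContinuousLinearMap.id ℝ E : E →L[ℝ] E) := by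
  rw [← tderiv_extChartAt_self (I := I) x₀]
  exact hasMFDerivAt_tderiv (mdifferentiableAt_extChartAt (mem_chart_source H x₀))

theorem chartField_self (x₀ : M) (V : ∀ x : M, TangentSpace I x) :
    chartField x₀ V (extChartAt I x₀ x₀) = V x₀ := by
  rw [chartField, extChartAt_to_inv, tderiv_extChartAt_self]; rfl

theorem hasMFDerivAt_of_comp_extChartAt_symm {f : M → F} {L : E →L[ℝ] F}
    (hf : HasFDerivAt (fun u ↦ f ((extChartAt I x₀).symm u)) L (extChartAt I x₀ x₀)) :
    HasMFDerivAt I 𝓘(ℝ, F) f x₀ L := by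
  have h := HasMFDerivAt.comp x₀ hf.hasMFDerivAt (hasMFDerivAt_extChartAt_self x₀)
  refine HasMFDerivAt.congr_of_eventuallyEq h ?_
  filter_upwards [extChartAt_source_mem_nhds (I := I) x₀] with x hx
  exact (congrArg f ((extChartAt I x₀).left_inv hx)).symm

variable [I.Boundaryless]

theorem hasMFDerivAt_extChartAt_symm_self (x₀ : M) :
    HasMFDerivAt 𝓘(ℝ, E) I (extChartAt I x₀).symm (extChartAt I x₀ x₀)
      (ContinuousLinearMap.id ℝ E : E →L[ℝ] E) := by
  have h : (mfderivWithin 𝓘(ℝ, E) I (extChartAt I x₀).symm (range I) (extChartAt I x₀ x₀) :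
      E →L[ℝ] E) = ContinuousLinearMap.id ℝ E := mfderivWithin_range_extChartAt_symm
  rw [← h]
  exact (mdifferentiableWithinAt_extChartAt_symm
    (mem_extChartAt_target (I := I) x₀)).hasMFDerivWithinAt.hasMFDerivAt
    (by rw [I.range_eq_univ]; exact univ_mem)

theorem fderiv_extChartAt_comp {f : M → M} (hf : MDifferentiableAt I I f x₀)
    (hfx₀ : f x₀ ∈ (extChartAt I x₀).source) :
    fderiv ℝ (fun u ↦ extChartAt I x₀ (f ((extChartAt I x₀).symm u))) (extChartAt I x₀ x₀) =
      (tderiv I 𝓘(ℝ, E) (extChartAt I x₀) (f x₀)).comp (tderiv I I f x₀) := by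
  have hchart : MDifferentiableAt I 𝓘(ℝ, E) (extChartAt I x₀) (f x₀) :=
    mdifferentiableAt_extChartAt (by rwa [← extChartAt_source (I := I)])
  have hsymm := hasMFDerivAt_extChartAt_symm_self (I := I) x₀
  rw [← mfderiv_eq_fderiv]
  change tderiv 𝓘(ℝ, E) 𝓘(ℝ, E) _ _ = _
  rw [tderiv_comp (f := fun u ↦ f ((extChartAt I x₀).symm u)) (y := f x₀) hchart
      (MDifferentiableAt.comp (g := f) (extChartAt I x₀ x₀) (by rwa [extChartAt_to_inv])
        hsymm.mdifferentiableAt) (by rw [extChartAt_to_inv]),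
    tderiv_comp hf hsymm.mdifferentiableAt (extChartAt_to_inv x₀),
    tderiv_eq_of_hasMFDerivAt hsymm, ContinuousLinearMap.comp_id]

theorem mpullbackWithin_extChartAt_symm_eventuallyEq (x₀ : M) (V : ∀ x : M, TangentSpace I x) :
    (VectorField.mpullbackWithin 𝓘(ℝ, E) I (extChartAt I x₀).symm V (range I) : E → E)
      =ᶠ[𝓝 (extChartAt I x₀ x₀)] chartField x₀ V := by
  filter_upwards [extChartAt_target_mem_nhds (I := I) x₀] with u hu
  rw [VectorField.mpullbackWithin_apply, ContinuousLinearMap.inverse_eq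
    (mfderivWithin_extChartAt_symm_comp_mfderiv_extChartAt hu)
    (mfderiv_extChartAt_comp_mfderivWithin_extChartAt_symm hu)]
  rfl

theorem mlieBracket_eq_of_hasFDerivAt_chartField {V W : ∀ x : M, TangentSpace I x}
    {A B : E →L[ℝ] E} {v w : E}
    (hV : HasFDerivAt (chartField (E := E) x₀ V) A (extChartAt I x₀ x₀)) (hv : V x₀ = v)
    (hW : HasFDerivAt (chartField (E := E) x₀ W) B (extChartAt I x₀ x₀)) (hw : W x₀ = w) :
    (VectorField.mlieBracket I V W x₀ : E) = B v - A w := by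
  subst hv hw
  have hlie := (VectorField.lieBracketWithin_of_mem_nhds (𝕜 := ℝ)
    (s := (extChartAt I x₀).symm ⁻¹' univ ∩ range I)
    (by rw [preimage_univ, univ_inter, I.range_eq_univ]; exact univ_mem)).trans
    (Filter.EventuallyEq.lieBracket_vectorField_eq (𝕜 := ℝ)
      (mpullbackWithin_extChartAt_symm_eventuallyEq x₀ V)
      (mpullbackWithin_extChartAt_symm_eventuallyEq x₀ W))
  have hid (w : E) : (tderiv I 𝓘(ℝ, E) (extChartAt I x₀) x₀).inverse w = w := by
    rw [tderiv_extChartAt_self, ContinuousLinearMap.inverse_id]; rfl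
  rw [← VectorField.mlieBracketWithin_univ, VectorField.mlieBracketWithin_apply]
  refine (hid _).trans (hlie.trans ?_)
  rw [VectorField.lieBracket, chartField_self, chartField_self, hV.fderiv, hW.fderiv]

end Charts

section MixedChart

variable {E : Type*} [NormedAddCommGroup E] [NormedSpace ℝ E] {H : Type*} [TopologicalSpace H]
  {I : ModelWithCorners ℝ E H} {M : Type*} [TopologicalSpace M] [ChartedSpace H M]
  {x₀ : M} {Φ : M × M → M}

theorem contMDiff_curry_left (hΦ : ContMDiff (I.prod I) I ∞ Φ) (x : M) :
    ContMDiff I I ∞ fun y ↦ Φ (x, y) :=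
  hΦ.comp (contMDiff_const.prodMk contMDiff_id)

theorem contMDiff_curry_right (hΦ : ContMDiff (I.prod I) I ∞ Φ) (y : M) :
    ContMDiff I I ∞ fun x ↦ Φ (x, y) :=
  hΦ.comp (contMDiff_id.prodMk contMDiff_const)

variable [IsManifold I ∞ M] [I.Boundaryless]

theorem contDiffAt_inChart (hΦ : ContMDiff (I.prod I) I ∞ Φ) (h₀ : Φ (x₀, x₀) = x₀) :
    ContDiffAt ℝ ∞ (inChart I x₀ Φ) (extChartAt I x₀ x₀, extChartAt I x₀ x₀) := by
  set u₀ := extChartAt I x₀ x₀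
  have hsymm : ContMDiffAt 𝓘(ℝ, E) I ∞ (extChartAt I x₀).symm u₀ :=
    (contMDiffOn_extChartAt_symm x₀).contMDiffAt (extChartAt_target_mem_nhds x₀)
  have hfst : ContMDiffAt 𝓘(ℝ, E × E) I ∞ (fun p : E × E ↦ (extChartAt I x₀).symm p.1) (u₀, u₀) :=
    ContMDiffAt.comp (g := (extChartAt I x₀).symm) _ hsymm contDiff_fst.contMDiff.contMDiffAt
  have hsnd : ContMDiffAt 𝓘(ℝ, E × E) I ∞ (fun p : E × E ↦ (extChartAt I x₀).symm p.2) (u₀, u₀) :=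
    ContMDiffAt.comp (g := (extChartAt I x₀).symm) _ hsymm contDiff_snd.contMDiff.contMDiffAt
  have hcomp := ContMDiffAt.comp (u₀, u₀) (g := Φ) hΦ.contMDiffAt (hfst.prodMk hsnd)
  rw [← contMDiffAt_iff_contDiffAt]
  refine ContMDiffAt.comp (g := extChartAt I x₀) _ ?_ hcomp
  simp only [u₀, extChartAt_to_inv, h₀]
  exact contMDiffAt_extChartAt

theorem hasFDerivAt_chartField_fst (hΦ : ContMDiff (I.prod I) I ∞ Φ) (h₀ : ∀ x, Φ (x₀, x) = x)
    {Z : E} {V : ∀ x : M, TangentSpace I x}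
    (hV : ∀ x, (V x : E) = tderiv I I (fun a ↦ Φ (a, x)) x₀ Z) :
    HasFDerivAt (chartField (E := E) x₀ V) (chartMixedDeriv I x₀ Φ Z) (extChartAt I x₀ x₀) := by
  refine (hasFDerivAt_fderiv_fst_apply (contDiffAt_inChart hΦ (h₀ x₀)) Z).congr_of_eventuallyEq ?_
  filter_upwards [eventually_symm_mem_source (I := I) x₀] with u hu
  have h := fderiv_extChartAt_comp (I := I) (x₀ := x₀)
    (mdifferentiableAt_of_smooth (contMDiff_curry_right hΦ ((extChartAt I x₀).symm u)))
    (by rwa [h₀])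
  simp only [inChart, h, h₀, chartField]
  exact congrArg _ (hV _)

theorem hasFDerivAt_chartField_snd (hΦ : ContMDiff (I.prod I) I ∞ Φ) (h₀ : ∀ x, Φ (x, x₀) = x)
    {Y : E} {V : ∀ x : M, TangentSpace I x}
    (hV : ∀ x, (V x : E) = tderiv I I (fun y ↦ Φ (x, y)) x₀ Y) :
    HasFDerivAt (chartField (E := E) x₀ V) ((chartMixedDeriv I x₀ Φ).flip Y)
      (extChartAt I x₀ x₀) := by
  have h := (ContinuousLinearMap.apply ℝ E Y).hasFDerivAt.comp _
    (hasFDerivAt_fderiv_snd (contDiffAt_inChart hΦ (h₀ x₀)))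
  refine HasFDerivAt.congr_of_eventuallyEq h ?_
  filter_upwards [eventually_symm_mem_source (I := I) x₀] with u hu
  have h := fderiv_extChartAt_comp (I := I) (x₀ := x₀)
    (mdifferentiableAt_of_smooth (contMDiff_curry_left hΦ ((extChartAt I x₀).symm u)))
    (by rwa [h₀])
  simp only [inChart, h, h₀, chartField, Function.comp_apply, ContinuousLinearMap.apply_apply]
  exact congrArg _ (hV _)

theorem hasMFDerivAt_tderiv_snd (hΦ : ContMDiff (I.prod I) I ∞ Φ) (h₀ : ∀ a, Φ (a, x₀) = x₀) :
    HasMFDerivAt I 𝓘(ℝ, E →L[ℝ] E) (fun a ↦ tderiv I I (fun y ↦ Φ (a, y)) x₀) x₀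
      (chartMixedDeriv I x₀ Φ : E →L[ℝ] E →L[ℝ] E) := by
  refine hasMFDerivAt_of_comp_extChartAt_symm (F := E →L[ℝ] E)
    ((hasFDerivAt_fderiv_snd (contDiffAt_inChart hΦ (h₀ x₀))).congr_of_eventuallyEq
      (Eventually.of_forall fun u ↦ ?_))
  have h := fderiv_extChartAt_comp (I := I) (x₀ := x₀)
    (mdifferentiableAt_of_smooth (contMDiff_curry_left hΦ ((extChartAt I x₀).symm u)))
    (by rw [h₀]; exact mem_extChartAt_source x₀)
  rw [h₀, tderiv_extChartAt_self, ContinuousLinearMap.id_comp] at h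
  exact h.symm

end MixedChart

section Multiplication

variable {E : Type*} [NormedAddCommGroup E] [NormedSpace ℝ E] {H : Type*} [TopologicalSpace H]
  {I : ModelWithCorners ℝ E H} {G : Type*} [TopologicalSpace G] [ChartedSpace H G] [Group G]

theorem rightInvariantField_one (X : GroupLieAlgebra I G) :
    (rightInvariantField X (1 : G) : E) = X := by
  change tderiv I I (fun x : G ↦ x * 1) 1 X = X
  simp only [mul_one, tderiv_id]
  rfl

/-- The multiplication of the tangent group `TG`, which is the differential of that of `G`. -/
noncomputable def tangentMul (p q : TangentBundle I G) : TangentBundle I G :=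
  ⟨p.1 * q.1, (tderiv I I (fun x ↦ x * q.1) p.1 p.2 + tderiv I I (fun y ↦ p.1 * y) q.1 q.2 : E)⟩

theorem tangentMul_zero (p : TangentBundle I G) (g : G) :
    tangentMul p ⟨g, 0⟩ = ⟨p.1 * g, (tderiv I I (fun x ↦ x * g) p.1 p.2 : E)⟩ :=
  totalSpace_mk_congr rfl ((congrArg _ (map_zero (tderiv I I (fun y ↦ p.1 * y) g))).trans
    (add_zero _))

variable [LieGroup I ∞ G]

theorem mdifferentiableAt_mul_const (g x : G) : MDifferentiableAt I I (fun y ↦ y * g) x :=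
  mdifferentiableAt_of_smooth contMDiff_mul_right

theorem mdifferentiableAt_const_mul (g x : G) : MDifferentiableAt I I (fun y ↦ g * y) x :=
  mdifferentiableAt_of_smooth contMDiff_mul_left

theorem mdifferentiableAt_inv (x : G) : MDifferentiableAt I I (fun y : G ↦ y⁻¹) x :=
  mdifferentiableAt_of_smooth (contMDiff_inv I ∞)

theorem mdifferentiableAt_conj (g x : G) : MDifferentiableAt I I (fun y ↦ g * y * g⁻¹) x :=
  mdifferentiableAt_of_smooth (contMDiff_mul_right.comp contMDiff_mul_left)

theorem mdifferentiableAt_mul (p : G × G) :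
    MDifferentiableAt (I.prod I) I (fun q : G × G ↦ q.1 * q.2) p :=
  mdifferentiableAt_of_smooth (contMDiff_mul I ∞)

theorem tderiv_mul_apply (p : G × G) (v w : E) :
    tderiv (I.prod I) I (fun q : G × G ↦ q.1 * q.2) p (v, w) =
      tderiv I I (fun x ↦ x * p.2) p.1 v + tderiv I I (fun y ↦ p.1 * y) p.2 w :=
  mfderiv_prod_eq_add_apply (v := ((v, w) : E × E)) (mdifferentiableAt_mul p)

theorem tderiv_fun_mul {f h : G → G} {x : G} (hf : MDifferentiableAt I I f x)
    (hh : MDifferentiableAt I I h x) (v : E) :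
    tderiv I I (fun y ↦ f y * h y) x v =
      tderiv I I (fun y ↦ y * h x) (f x) (tderiv I I f x v) +
        tderiv I I (fun y ↦ f x * y) (h x) (tderiv I I h x v) := by
  rw [tderiv_comp_apply (g := fun q : G × G ↦ q.1 * q.2) (f := fun y ↦ (f y, h y))
    (mdifferentiableAt_mul _) (hf.prodMk hh) rfl v, tderiv_prodMk hf hh]
  exact tderiv_mul_apply (f x, h x) _ _

theorem HasVelocityAt.mul {γ η : ℝ → G} {t : ℝ} {v w : E} (hγ : HasVelocityAt I γ t v)
    (hη : HasVelocityAt I η t w) :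
    HasVelocityAt I (fun s ↦ γ s * η s) t
      (tderiv I I (fun y ↦ y * η t) (γ t) v + tderiv I I (fun y ↦ γ t * y) (η t) w) := by
  rw [← tderiv_mul_apply (γ t, η t)]
  exact (hγ.prodMk hη).comp (mdifferentiableAt_mul (γ t, η t)) rfl

theorem tderiv_inv_one (v : E) : tderiv I I (fun x : G ↦ x⁻¹) 1 v = -v := by
  have h := tderiv_fun_mul (I := I) (f := fun x : G ↦ x) (x := 1) mdifferentiableAt_id
    (mdifferentiableAt_inv 1) v
  simp only [mul_inv_cancel, inv_one, mul_one, one_mul, tderiv_const, tderiv_id,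
    ContinuousLinearMap.id_apply, zero_apply] at h
  exact (neg_eq_of_add_eq_zero_right h.symm).symm

theorem tderiv_mul_const_mul_const (g h x : G) (v : E) :
    tderiv I I (fun y ↦ y * h) (x * g) (tderiv I I (fun y ↦ y * g) x v) =
      tderiv I I (fun y ↦ y * (g * h)) x v := by
  rw [← tderiv_comp_apply (mdifferentiableAt_mul_const h _) (mdifferentiableAt_mul_const g _) rfl]
  simp only [mul_assoc]

theorem tderiv_mul_const_rightInvariantField (X : GroupLieAlgebra I G) (g x : G) :
    (tderiv I I (fun y ↦ y * x) g (rightInvariantField X g) : E) =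
      rightInvariantField X (g * x) := by
  have h := tderiv_mul_const_mul_const (E := E) (I := I) g x 1 X
  rw [one_mul] at h
  exact h

theorem tderiv_inv_tderiv_mul_const (X : E) (g : G) :
    tderiv I I (fun x ↦ x⁻¹) g⁻¹ (tderiv I I (fun x ↦ x * g⁻¹) 1 X) =
      tderiv I I (fun x ↦ g * x) 1 (-X) := by
  rw [← tderiv_inv_one (I := I) (G := G), ← tderiv_comp_apply (mdifferentiableAt_inv _)
    (mdifferentiableAt_mul_const _ _) (one_mul _), ← tderiv_comp_apply
    (mdifferentiableAt_const_mul _ _) (mdifferentiableAt_inv _) inv_one]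
  simp only [mul_inv_rev, inv_inv]

theorem invPushforward_rightInvariantField (X : GroupLieAlgebra I G) :
    invPushforward (rightInvariantField X : ∀ g : G, TangentSpace I g) =
      mulInvariantVectorField (-X) :=
  funext fun g ↦ tderiv_inv_tderiv_mul_const (E := E) X g

theorem tderiv_conj_left (X : E) (g : G) :
    tderiv I I (fun a : G ↦ a * g * a⁻¹) 1 X =
      tderiv I I (fun x ↦ x * g) 1 X - tderiv I I (fun x ↦ g * x) 1 X := by
  have h := tderiv_fun_mul (I := I) (x := (1 : G)) (mdifferentiableAt_mul_const g 1)
    (mdifferentiableAt_inv 1) X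
  simp only [tderiv_inv_one, map_neg, inv_one, mul_one, one_mul, tderiv_id] at h
  rw [sub_eq_add_neg]
  exact h

theorem rightInvariantField_add_invPushforward (X : GroupLieAlgebra I G) (g : G) :
    (rightInvariantField X g + invPushforward (rightInvariantField X) g : E) =
      tderiv I I (fun a : G ↦ a * g * a⁻¹) 1 X := by
  have h (v : E) : tderiv I I (fun x ↦ x * g) 1 v +
      tderiv I I (fun x ↦ x⁻¹) g⁻¹ (tderiv I I (fun x ↦ x * g⁻¹) 1 v) =
      tderiv I I (fun a : G ↦ a * g * a⁻¹) 1 v := by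
    rw [tderiv_inv_tderiv_mul_const, map_neg, tderiv_conj_left, sub_eq_add_neg]
  exact h X

theorem contMDiff_tangentMul :
    ContMDiff (I.tangent.prod I.tangent) I.tangent ∞
      (fun p : TangentBundle I G × TangentBundle I G ↦ tangentMul p.1 p.2) := by
  have hsplit : ContMDiff (I.tangent.prod I.tangent) (I.prod I).tangent ∞
      (equivTangentBundleProd I G I G).symm := contMDiff_equivTangentBundleProd_symm
  have hmap : ContMDiff (I.prod I).tangent I.tangent ∞
      (tangentMap (I.prod I) I (fun p : G × G ↦ p.1 * p.2)) :=
    (contMDiff_mul I ∞).contMDiff_tangentMap (m := ∞) le_rfl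
  exact (hmap.comp hsplit).congr fun p ↦
    totalSpace_mk_congr rfl (tderiv_mul_apply (E := E) (p.1.1, p.2.1) p.1.2 p.2.2).symm

theorem isSmoothField_rightInvariantField (X : GroupLieAlgebra I G) :
    IsSmoothField I (rightInvariantField X : ∀ g : G, TangentSpace I g) := by
  have h : ContMDiff I (I.tangent.prod I.tangent) ∞ fun g : G ↦
      ((⟨1, X⟩, ⟨g, 0⟩) : TangentBundle I G × TangentBundle I G) :=
    contMDiff_const.prodMk (Bundle.contMDiff_zeroSection ℝ _)
  refine (contMDiff_tangentMul.comp h).congr fun g ↦ ?_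
  exact (totalSpace_mk_congr (E := E) (one_mul g).symm rfl).trans (tangentMul_zero ⟨1, X⟩ g).symm

theorem IsSmoothField.contMDiff_one {V : ∀ g : G, TangentSpace I g} (hV : IsSmoothField I V) :
    ContMDiff I I.tangent 1 (fun g ↦ (⟨g, V g⟩ : TangentBundle I G)) :=
  ContMDiff.of_le hV ENat.LEInfty.out

end Multiplication

section AdjointRepresentation

variable {E : Type*} [NormedAddCommGroup E] [NormedSpace ℝ E] {H : Type*} [TopologicalSpace H]
  {I : ModelWithCorners ℝ E H} {G : Type*} [TopologicalSpace G] [ChartedSpace H G] [Group G]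

theorem mulInvariantVectorField_one (Y : GroupLieAlgebra I G) :
    (mulInvariantVectorField Y (1 : G) : E) = Y := by
  change tderiv I I (fun x : G ↦ 1 * x) 1 Y = Y
  simp only [one_mul, tderiv_id]
  rfl

variable [LieGroup I ∞ G]

variable (I) in
/-- The adjoint representation of `G` on the model space of its Lie algebra. -/
noncomputable def adjointRep : G →* (E →L[ℝ] E) where
  toFun g := tderiv I I (fun x : G ↦ g * x * g⁻¹) 1
  map_one' := by
    simp only [one_mul, inv_one, mul_one]
    exact tderiv_id 1
  map_mul' g h := by
    rw [ContinuousLinearMap.mul_def, ← tderiv_comp (mdifferentiableAt_conj g 1)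
      (mdifferentiableAt_conj h 1) (by rw [mul_one, mul_inv_cancel])]
    simp only [mul_inv_rev, mul_assoc]

theorem adjointRep_apply (g : G) : adjointRep I g = tderiv I I (fun x : G ↦ g * x * g⁻¹) 1 := rfl

variable (I G) in
/-- The differential at the identity of the adjoint representation, that is, the map `ad`. -/
noncomputable def adjointDeriv : E →L[ℝ] E →L[ℝ] E :=
  tderiv I 𝓘(ℝ, E →L[ℝ] E) (adjointRep I : G → E →L[ℝ] E) 1

theorem contMDiff_conj : ContMDiff (I.prod I) I ∞ fun p : G × G ↦ p.1 * p.2 * p.1⁻¹ :=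
  (contMDiff_mul I ∞).mul contMDiff_fst.inv

variable [I.Boundaryless]

theorem hasMFDerivAt_adjointRep_one_chartMixedDeriv :
    HasMFDerivAt I 𝓘(ℝ, E →L[ℝ] E) (adjointRep I : G → E →L[ℝ] E) 1
      (chartMixedDeriv I (1 : G) fun p ↦ p.1 * p.2 * p.1⁻¹ : E →L[ℝ] E →L[ℝ] E) :=
  hasMFDerivAt_tderiv_snd contMDiff_conj fun a ↦ by rw [mul_one, mul_inv_cancel]

theorem hasMFDerivAt_adjointRep_one :
    HasMFDerivAt I 𝓘(ℝ, E →L[ℝ] E) (adjointRep I : G → E →L[ℝ] E) 1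
      (adjointDeriv I G : E →L[ℝ] E →L[ℝ] E) :=
  hasMFDerivAt_tderiv hasMFDerivAt_adjointRep_one_chartMixedDeriv.mdifferentiableAt

theorem hasFDerivAt_chartField_rightInvariantField (Z : E) :
    HasFDerivAt (chartField (E := E) (1 : G) (rightInvariantField (I := I) Z))
      (chartMixedDeriv I (1 : G) (fun p ↦ p.1 * p.2) Z) (extChartAt I (1 : G) 1) :=
  hasFDerivAt_chartField_fst (contMDiff_mul I ∞) one_mul fun _ ↦ rfl

theorem hasFDerivAt_chartField_mulInvariantVectorField (Y : E) :
    HasFDerivAt (chartField (E := E) (1 : G) (mulInvariantVectorField (I := I) Y))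
      ((chartMixedDeriv I (1 : G) fun p ↦ p.1 * p.2).flip Y) (extChartAt I (1 : G) 1) :=
  hasFDerivAt_chartField_snd (contMDiff_mul I ∞) mul_one fun _ ↦ rfl

theorem lie_eq_chartMixedDeriv (Z Y : GroupLieAlgebra I G) :
    (⁅Z, Y⁆ : GroupLieAlgebra I G) =
      (chartMixedDeriv I (1 : G) (fun p ↦ p.1 * p.2) Z Y -
        chartMixedDeriv I (1 : G) (fun p ↦ p.1 * p.2) Y Z : E) :=
  (mlieBracket_eq_of_hasFDerivAt_chartField
    (hasFDerivAt_chartField_mulInvariantVectorField (E := E) Z) (mulInvariantVectorField_one Z)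
    (hasFDerivAt_chartField_mulInvariantVectorField (E := E) Y)
    (mulInvariantVectorField_one Y)).trans rfl

theorem mlieBracket_rightInvariantField_mulInvariantVectorField (X Y : GroupLieAlgebra I G) :
    VectorField.mlieBracket I (rightInvariantField X) (mulInvariantVectorField Y) (1 : G) = 0 :=
  (mlieBracket_eq_of_hasFDerivAt_chartField
    (hasFDerivAt_chartField_rightInvariantField (E := E) X)
    (rightInvariantField_one X) (hasFDerivAt_chartField_mulInvariantVectorField (E := E) Y)
    (mulInvariantVectorField_one Y)).trans (sub_self _)

theorem adjointDeriv_apply (Z Y : GroupLieAlgebra I G) :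
    (adjointDeriv I G Z Y : GroupLieAlgebra I G) = ⁅Z, Y⁆ := by
  have hconj := hasFDerivAt_chartField_fst (E := E) (I := I) (Z := Z)
    (V := fun x : G ↦ rightInvariantField Z x + invPushforward (rightInvariantField Z) x)
    contMDiff_conj (fun x ↦ by simp) (rightInvariantField_add_invPushforward Z)
  rw [invPushforward_rightInvariantField] at hconj
  have h := hconj.unique (hasFDerivAt_chartField_add
    (hasFDerivAt_chartField_rightInvariantField (E := E) (I := I) (G := G) Z)
    (hasFDerivAt_chartField_mulInvariantVectorField (E := E) (-Z)))
  have happly (L : E →L[ℝ] E) (M : E →L[ℝ] E →L[ℝ] E) (Z Y : E) (h : L = M Z + M.flip (-Z)) :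
      L Y = M Z Y - M Y Z := by
    simp [h, sub_eq_add_neg]
  rw [lie_eq_chartMixedDeriv, adjointDeriv,
    tderiv_eq_of_hasMFDerivAt hasMFDerivAt_adjointRep_one_chartMixedDeriv]
  exact happly _ _ _ _ h

theorem derivationOf_apply [CompleteSpace E] {X : GroupLieAlgebra I G}
    {V : ∀ g : G, TangentSpace I g}
    (hVX : ∀ g, V g = rightInvariantField X g + invPushforward (rightInvariantField X) g)
    (Y : GroupLieAlgebra I G) : derivationOf V Y = ⁅X, Y⁆ := by
  obtain rfl : V = rightInvariantField X + mulInvariantVectorField (-X) := by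
    rw [← invPushforward_rightInvariantField]
    exact funext hVX
  change -VectorField.mlieBracket I _ _ _ = _
  rw [VectorField.mlieBracket_add_left, mlieBracket_rightInvariantField_mulInvariantVectorField,
    zero_add, ← GroupLieAlgebra.bracket_def, neg_lie, neg_neg]
  · exact (isSmoothField_rightInvariantField X).contMDiff_one.mdifferentiableAt one_ne_zero
  · exact mdifferentiableAt_mulInvariantVectorField _

theorem continuous_adjointRep : Continuous (adjointRep I : G → E →L[ℝ] E) := by
  have : IsTopologicalGroup G := topologicalGroup_of_lieGroup I ∞
  exact continuous_of_continuousAt_one (adjointRep I) hasMFDerivAt_adjointRep_one.continuousAt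

theorem injective_adjointDeriv
    (hcenter : ∀ Z : GroupLieAlgebra I G, (∀ Y : GroupLieAlgebra I G, ⁅Z, Y⁆ = 0) → Z = 0) :
    Function.Injective (adjointDeriv I G) :=
  (injective_iff_map_eq_zero _).2 fun Z hZ ↦ hcenter Z fun Y ↦
    (adjointDeriv_apply Z Y).symm.trans (congrArg (fun L : E →L[ℝ] E ↦ L Y) hZ)

theorem finite_ker_adjointRep [FiniteDimensional ℝ E] [CompactSpace G]
    (hcenter : ∀ Z : GroupLieAlgebra I G, (∀ Y : GroupLieAlgebra I G, ⁅Z, Y⁆ = 0) → Z = 0) :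
    Finite (adjointRep I : G →* (E →L[ℝ] E)).ker := by
  have : IsTopologicalGroup G := topologicalGroup_of_lieGroup I ∞
  have hne := eventually_ne_of_hasMFDerivAt (F := E →L[ℝ] E)
    (hasMFDerivAt_adjointRep_one (I := I) (G := G)) (injective_adjointDeriv hcenter)
  rw [eventually_nhdsWithin_iff, map_one] at hne
  have hdiscrete : DiscreteTopology (adjointRep I : G →* (E →L[ℝ] E)).ker := by
    rw [discreteTopology_iff_isOpen_singleton_one, isOpen_iff_mem_nhds]
    rintro _ rfl
    filter_upwards [continuous_subtype_val.continuousAt.eventually hne] with a ha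
    exact Subtype.ext (not_not.1 fun h ↦ ha h (MonoidHom.mem_ker.1 a.2))
  have hclosed : IsClosed ((adjointRep I : G →* (E →L[ℝ] E)).ker : Set G) :=
    isClosed_singleton.preimage continuous_adjointRep
  have : CompactSpace (adjointRep I : G →* (E →L[ℝ] E)).ker :=
    isCompact_iff_compactSpace.1 hclosed.isCompact
  exact finite_of_compact_of_discrete

end AdjointRepresentation

section OneParameterSubgroups

variable {E : Type*} [NormedAddCommGroup E] [NormedSpace ℝ E] {H : Type*} [TopologicalSpace H]
  {I : ModelWithCorners ℝ E H} {G : Type*} [TopologicalSpace G] [ChartedSpace H G]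
  [Group G] {X : GroupLieAlgebra I G} {γ : ℝ → G}

theorem hasVelocityAt_of_eq_one (hγ : IsMIntegralCurve (I := I) γ (rightInvariantField X)) {t : ℝ}
    (ht : γ t = 1) : HasVelocityAt (E := E) I γ t X := by
  have h : HasVelocityAt (E := E) I γ t (rightInvariantField X (γ t)) := hγ t
  rw [ht, rightInvariantField_one] at h
  exact h

variable [LieGroup I ∞ G]

theorem hasVelocityAt_mul_const_rightInvariantField {t : ℝ} (x : G)
    (hγ : HasVelocityAt (E := E) I γ t (rightInvariantField X (γ t))) :
    HasVelocityAt (E := E) I (fun s ↦ γ s * x) t (rightInvariantField X (γ t * x)) := by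
  rw [← tderiv_mul_const_rightInvariantField]
  exact hγ.comp (mdifferentiableAt_mul_const x _) rfl

variable [I.Boundaryless] [T2Space G]

theorem IsSmoothField.eq_of_isMIntegralCurve {V : ∀ g : G, TangentSpace I g}
    (hV : IsSmoothField I V) {η : ℝ → G} (hγ : IsMIntegralCurve (I := I) γ V)
    (hη : IsMIntegralCurve (I := I) η V) (h0 : γ 0 = η 0) : γ = η :=
  isMIntegralCurve_Ioo_eq_of_contMDiff_boundaryless hV.contMDiff_one hγ hη h0

/- Right translation moves a local integral curve through `1` to one through any `x`, defined for
the same length of time; hence integral curves extend to all times. -/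
theorem exists_isMIntegralCurve_rightInvariantField [CompleteSpace E] (X : GroupLieAlgebra I G) :
    ∃ γ : ℝ → G, γ 0 = 1 ∧ IsMIntegralCurve (I := I) γ (rightInvariantField X) := by
  have hV := (isSmoothField_rightInvariantField X).contMDiff_one
  obtain ⟨γ, h0, hγ⟩ := exists_isMIntegralCurveAt_of_contMDiffAt_boundaryless (I := I)
    (t₀ := 0) (hV.contMDiffAt (x := (1 : G)))
  obtain ⟨ε, hε, hγ⟩ := isMIntegralCurveAt_iff'.1 hγ
  rw [Real.ball_eq_Ioo, zero_sub, zero_add] at hγ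
  refine exists_isMIntegralCurve_of_isMIntegralCurveOn hV hε (fun x ↦ ?_) 1
  refine ⟨fun t ↦ γ t * x, by simp [h0], fun t ht ↦ ?_⟩
  exact HasMFDerivAt.hasMFDerivWithinAt <| hasVelocityAt_mul_const_rightInvariantField x
    ((hγ t ht).hasMFDerivAt (isOpen_Ioo.mem_nhds ht))

variable (h0 : γ 0 = 1) (hγ : IsMIntegralCurve (I := I) γ (rightInvariantField X))
include h0 hγ

theorem integralCurve_add (s t : ℝ) : γ (s + t) = γ s * γ t :=
  congrFun ((isSmoothField_rightInvariantField X).eq_of_isMIntegralCurve (hγ.comp_add t)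
    (fun s ↦ hasVelocityAt_mul_const_rightInvariantField (γ t) (hγ s)) (by simp [h0])) s

theorem lieExp_smul (t : ℝ) : lieExp (t • X) = γ t := by
  have hsmul : (rightInvariantField (t • X) : ∀ g : G, TangentSpace I g) =
      t • rightInvariantField X :=
    funext fun g ↦ map_smul (tderiv (E := E) I I (fun x : G ↦ x * g) 1) t X
  have hγt : IsMIntegralCurve (I := I) (γ ∘ (· * t)) (rightInvariantField (t • X)) := by
    rw [hsmul]
    exact hγ.comp_mul t
  have hex : ∃ η : ℝ → G, η 0 = 1 ∧ IsMIntegralCurve (I := I) η (rightInvariantField (t • X)) :=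
    ⟨γ ∘ (· * t), by simp [h0], hγt⟩
  rw [lieExp, dif_pos hex, (isSmoothField_rightInvariantField (t • X)).eq_of_isMIntegralCurve
    hex.choose_spec.2 hγt (by simp [h0, hex.choose_spec.1])]
  simp

theorem hasVelocityAt_conj (g : G) (t : ℝ) :
    HasVelocityAt (E := E) I (fun s ↦ γ s * g * (γ s)⁻¹) t
      (tderiv (E := E) I I (fun a : G ↦ a * (γ t * g * (γ t)⁻¹) * a⁻¹) 1 X) := by
  set y := γ t * g * (γ t)⁻¹ with hy
  have hshift : HasVelocityAt (E := E) I (fun s ↦ γ (s - t)) t X :=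
    hasVelocityAt_of_eq_one (hγ.comp_add (-t)) (by simp [h0])
  have h := hshift.comp (f := fun a ↦ a * y * a⁻¹) (x := 1) (mdifferentiableAt_of_smooth
    (contMDiff_curry_right contMDiff_conj y)) (by rw [sub_self, h0])
  convert h using 2 with s
  have hs : γ s = γ (s - t) * γ t := by rw [← integralCurve_add h0 hγ, sub_add_cancel]
  rw [hs, hy]
  group

theorem flow_eq_conj {V : ∀ g : G, TangentSpace I g} (hV : IsSmoothField I V)
    (hVX : ∀ g, V g = rightInvariantField X g + invPushforward (rightInvariantField X) g)
    {φ : ℝ → G → G} (hφ : IsFlowOf I φ V) (t : ℝ) (g : G) : φ t g = γ t * g * (γ t)⁻¹ := by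
  refine congrFun (hV.eq_of_isMIntegralCurve (γ := fun t ↦ φ t g)
    (η := fun t ↦ γ t * g * (γ t)⁻¹) (hφ g).2 (fun t ↦ ?_) (by simp [h0, (hφ g).1])) t
  rw [hVX]
  exact (congrArg (HasVelocityAt (E := E) I (fun s ↦ γ s * g * (γ s)⁻¹) t)
    (rightInvariantField_add_invPushforward X _)).mpr (hasVelocityAt_conj h0 hγ g t)

theorem adjointRep_eq_exp [CompleteSpace E] (t : ℝ) :
    adjointRep I (γ t) = NormedSpace.exp (t • adjointDeriv I G X) := by
  have hderiv := ((hasVelocityAt_of_eq_one hγ h0).comp (f := (adjointRep I : G → E →L[ℝ] E))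
    hasMFDerivAt_adjointRep_one.mdifferentiableAt h0).hasDerivAt
  exact eq_exp_of_hasDerivAt (a := fun t ↦ adjointRep I (γ t)) (by rw [h0, map_one])
    (fun s t ↦ by rw [integralCurve_add h0 hγ, map_mul]) hderiv t

theorem expFlow_eq_adjointRep [FiniteDimensional ℝ E] [CompleteSpace E]
    {V : ∀ g : G, TangentSpace I g}
    (hVX : ∀ g, V g = rightInvariantField X g + invPushforward (rightInvariantField X) g) (t : ℝ) :
    expFlow (derivationOf V) t = adjointRep I (γ t) := by
  let D : E →ₗ[ℝ] E := derivationOf V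
  have h : LinearMap.toContinuousLinearMap D = adjointDeriv I G X :=
    ContinuousLinearMap.ext fun Y ↦ (derivationOf_apply hVX Y).trans (adjointDeriv_apply X Y).symm
  rw [adjointRep_eq_exp h0 hγ, ← h]
  rfl

end OneParameterSubgroups

section CentralElements

theorem exists_eq_top_of_isClosed_of_forall_exists_mem {G : Type*} [Group G] [TopologicalSpace G]
    [IsTopologicalGroup G] [ConnectedSpace G] [BaireSpace G] {ι : Type*} [Countable ι]
    {K : ι → Subgroup G} (hclosed : ∀ i, IsClosed (K i : Set G)) (hcover : ∀ g, ∃ i, g ∈ K i) :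
    ∃ i, K i = ⊤ := by
  obtain ⟨i, g, hg⟩ := nonempty_interior_of_iUnion_of_closed hclosed
    (eq_univ_of_forall fun g ↦ mem_iUnion.2 (hcover g))
  have hopen : IsOpen (K i : Set G) := (K i).isOpen_of_mem_nhds (mem_interior_iff_mem_nhds.1 hg)
  exact ⟨i, SetLike.coe_injective (IsClopen.eq_univ ⟨hclosed i, hopen⟩ ⟨1, (K i).one_mem⟩)⟩

/-- The subgroup of the elements on which a multiplicative map `ρ` takes values commuting with
`d`. -/
def commutingSubgroup {G A : Type*} [Group G] [Monoid A] (ρ : G →* A) (d : A) : Subgroup G where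
  __ := (Submonoid.centralizer {d}).comap ρ
  inv_mem' {g} hg := by
    have hcomm : Commute d (ρ.toHomUnits g) := hg d rfl
    rintro _ rfl
    exact hcomm.units_inv_right

theorem mem_commutingSubgroup {G A : Type*} [Group G] [Monoid A] {ρ : G →* A} {d : A} {g : G} :
    g ∈ commutingSubgroup ρ d ↔ Commute d (ρ g) :=
  forall_eq

theorem isClosed_commutingSubgroup {G A : Type*} [Group G] [TopologicalSpace G] [Monoid A]
    [TopologicalSpace A] [ContinuousMul A] [T2Space A] {ρ : G →* A} (hρ : Continuous ρ) (d : A) :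
    IsClosed (commutingSubgroup ρ d : Set G) :=
  (Set.isClosed_centralizer {d}).preimage hρ

variable {E : Type*} [NormedAddCommGroup E] [NormedSpace ℝ E] {H : Type*} [TopologicalSpace H]
  {I : ModelWithCorners ℝ E H} {G : Type*} [TopologicalSpace G] [ChartedSpace H G]
  [Group G] [LieGroup I ∞ G]

theorem adjointRep_eq_one_of_forall_commute {a : G} (ha : ∀ g, Commute a g) :
    adjointRep I a = 1 := by
  simp only [adjointRep_apply, (ha _).eq, mul_inv_cancel_right]
  exact tderiv_id 1

variable [I.Boundaryless] {X : GroupLieAlgebra I G}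

theorem commute_adjointDeriv_of_forall_commute_adjointRep {d : E →L[ℝ] E}
    (hd : ∀ g : G, Commute d (adjointRep I g)) (Y : E) : Commute d (adjointDeriv I G Y) := by
  let c : (E →L[ℝ] E) →L[ℝ] (E →L[ℝ] E) :=
    ContinuousLinearMap.mul ℝ (E →L[ℝ] E) d - (ContinuousLinearMap.mul ℝ (E →L[ℝ] E)).flip d
  have hc (m : E →L[ℝ] E) : c m = 0 ↔ Commute d m := sub_eq_zero
  have hconst : (fun g : G ↦ c (adjointRep I g)) = fun _ ↦ 0 := funext fun g ↦ (hc _).2 (hd g)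
  have hderiv := tderiv_comp_apply (I'' := 𝓘(ℝ, E →L[ℝ] E)) c.mdifferentiableAt
    (hasMFDerivAt_adjointRep_one (I := I) (G := G)).mdifferentiableAt rfl Y
  rw [hconst, tderiv_const, tderiv_eq_of_hasMFDerivAt c.hasMFDerivAt] at hderiv
  exact (hc _).1 hderiv.symm

theorem eq_zero_of_forall_commute_adjointRep [CompleteSpace E]
    (hcenter : ∀ Z : GroupLieAlgebra I G, (∀ Y : GroupLieAlgebra I G, ⁅Z, Y⁆ = 0) → Z = 0)
    (hX : ∀ g : G, Commute (adjointDeriv I G X) (adjointRep I g)) : X = 0 := by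
  have hlie (Y Z : GroupLieAlgebra I G) : ⁅X, ⁅Y, Z⁆⁆ = ⁅Y, ⁅X, Z⁆⁆ := by
    have h : adjointDeriv I G X (adjointDeriv I G Y Z) =
        adjointDeriv I G Y (adjointDeriv I G X Z) :=
      congrArg (fun L : E →L[ℝ] E ↦ L Z) (commute_adjointDeriv_of_forall_commute_adjointRep hX Y)
    simp only [adjointDeriv_apply] at h
    exact h
  refine hcenter X fun Y ↦ hcenter _ fun Z ↦ ?_
  rw [lie_lie, hlie, sub_self]

theorem exists_adjointRep_eq_one [FiniteDimensional ℝ E] [T2Space G] [BaireSpace G]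
    [ConnectedSpace G]
    (hcenter : ∀ Z : GroupLieAlgebra I G, (∀ Y : GroupLieAlgebra I G, ⁅Z, Y⁆ = 0) → Z = 0)
    {γ : ℝ → G} (h0 : γ 0 = 1) (hγ : IsMIntegralCurve (I := I) γ (rightInvariantField X))
    (hper : ∀ g : G, ∃ s > 0, Commute (γ s) g) : ∃ s > 0, adjointRep I (γ s) = 1 := by
  have : CompleteSpace E := FiniteDimensional.complete ℝ E
  have : IsTopologicalGroup G := topologicalGroup_of_lieGroup I ∞
  have hexp := adjointRep_eq_exp h0 hγ
  set d := adjointDeriv I G X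
  let S : Set ℝ := {s | ∃ m, Commute (NormedSpace.exp (s • d)) m ∧ ¬Commute d m} ∩ Ioi 0
  have : Countable S := ((countable_setOf_commute_exp_smul d).mono inter_subset_left).to_subtype
  let K : Option S → Subgroup G := fun i ↦
    i.elim (commutingSubgroup (adjointRep I) d) fun s ↦ Subgroup.centralizer {γ s}
  have hclosed : ∀ i, IsClosed (K i : Set G) := by
    rintro (_ | s)
    · exact isClosed_commutingSubgroup continuous_adjointRep d
    · exact Set.isClosed_centralizer _
  have hcover (g : G) : ∃ i, g ∈ K i := by
    obtain ⟨s, hs, hsg⟩ := hper g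
    by_cases hd : Commute d (adjointRep I g)
    · exact ⟨none, mem_commutingSubgroup.2 hd⟩
    · have hs_comm : Commute (NormedSpace.exp (s • d)) (adjointRep I g) :=
        hexp s ▸ hsg.map (adjointRep I)
      exact ⟨some ⟨s, ⟨_, hs_comm, hd⟩, hs⟩, Subgroup.mem_centralizer_singleton_iff.2 hsg.symm⟩
  obtain ⟨i, hi⟩ := exists_eq_top_of_isClosed_of_forall_exists_mem hclosed hcover
  have hmem (g : G) : g ∈ K i := hi ▸ Subgroup.mem_top g
  rcases i with _ | s
  · obtain rfl : X = 0 := eq_zero_of_forall_commute_adjointRep hcenter fun g ↦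
      mem_commutingSubgroup.1 (hmem g)
    have hd : d = 0 := map_zero (adjointDeriv I G)
    exact ⟨1, one_pos, by rw [hexp, hd, smul_zero, NormedSpace.exp_zero]⟩
  · exact ⟨s, s.2.2, adjointRep_eq_one_of_forall_commute fun g ↦
      (Subgroup.mem_centralizer_singleton_iff.1 (hmem g)).symm⟩

end CentralElements

section LinearVectorFields

theorem exists_coboundary_of_cocycle {E : Type*} [NormedAddCommGroup E] [NormedSpace ℝ E]
    [CompleteSpace E] {G : Type*} [Group G] [TopologicalSpace G] [IsTopologicalGroup G]
    [CompactSpace G] (ρ : G → E →L[ℝ] E) {c : G → E} (hc : Continuous c)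
    (hcocycle : ∀ g h, c (g * h) = c g + ρ g (c h)) : ∃ X, ∀ g, c g = X - ρ g X := by
  let : MeasurableSpace G := borel G
  have : BorelSpace G := ⟨rfl⟩
  let μ : Measure G := Measure.haarMeasure ⊤
  have : IsProbabilityMeasure μ :=
    ⟨by simpa using Measure.haarMeasure_self (K₀ := (⊤ : TopologicalSpace.PositiveCompacts G))⟩
  have hint {f : G → E} (hf : Continuous f) : Integrable f μ :=
    hf.integrable_of_hasCompactSupport (HasCompactSupport.of_compactSpace f)
  refine ⟨∫ h, c h ∂μ, fun g ↦ eq_sub_of_add_eq ?_⟩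
  calc c g + ρ g (∫ h, c h ∂μ)
      = ∫ h, (c g + ρ g (c h)) ∂μ := by
        rw [integral_add (integrable_const _) (hint (f := fun h ↦ ρ g (c h)) (by fun_prop)),
          (ρ g).integral_comp_comm (hint hc), integral_const, probReal_univ, one_smul]
    _ = ∫ h, c (g * h) ∂μ := by simp only [hcocycle]
    _ = ∫ h, c h ∂μ := integral_mul_left_eq_self c g

variable {E : Type*} [NormedAddCommGroup E] [NormedSpace ℝ E] {H : Type*} [TopologicalSpace H]
  {I : ModelWithCorners ℝ E H} {G : Type*} [TopologicalSpace G] [ChartedSpace H G] [Group G]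
  {V : ∀ g : G, TangentSpace I g}

/-- The values of a vector field, translated to the identity by right multiplications. -/
noncomputable def rightTranslate (V : ∀ g : G, TangentSpace I g) (g : G) : E :=
  tderiv I I (fun x ↦ x * g⁻¹) g (V g)

variable [LieGroup I ∞ G]

theorem continuous_rightTranslate (hV : IsSmoothField I V) :
    Continuous (rightTranslate V : G → E) := by
  have hfield : ContMDiff I (I.tangent.prod I.tangent) ∞
      fun g : G ↦ ((⟨g, V g⟩, ⟨g⁻¹, 0⟩) : TangentBundle I G × TangentBundle I G) :=
    ContMDiff.prodMk hV ((Bundle.contMDiff_zeroSection ℝ _).comp (contMDiff_inv I ∞))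
  have hone : Continuous fun g ↦ (⟨1, rightTranslate (E := E) V g⟩ : TangentBundle I G) :=
    (contMDiff_tangentMul.comp hfield).continuous.congr fun g ↦
      (tangentMul_zero ⟨g, V g⟩ g⁻¹).trans (totalSpace_mk_congr (mul_inv_cancel g) rfl)
  let e := trivializationAt E (TangentSpace I) (1 : G)
  have hsnd : Continuous fun g ↦ (e ⟨1, rightTranslate (E := E) V g⟩).2 :=
    continuous_snd.comp (e.continuousOn.comp_continuous hone fun _ ↦
      e.mem_source.2 (mem_chart_source H (1 : G)))
  refine hsnd.congr fun g ↦ ?_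
  simp only [e, TangentBundle.trivializationAt_apply]
  exact congrArg (fun L : E →L[ℝ] E ↦ L (rightTranslate V g))
    (fderivWithin_extChartAt_comp_extChartAt_symm_range (I := I) (x := (1 : G)))

theorem tderiv_mul_const_rightTranslate (g : G) :
    (tderiv I I (fun x ↦ x * g) 1 (rightTranslate V g) : E) = V g := by
  have h := tderiv_mul_const_mul_const (I := I) g⁻¹ g g (V g)
  simp only [mul_inv_cancel, inv_mul_cancel, mul_one, tderiv_id] at h
  exact h

theorem IsLinearVectorField.apply_mul (hV : IsLinearVectorField I V) (g h : G) :
    (V (g * h) : E) = tderiv I I (fun y ↦ y * h) g (V g) + tderiv I I (fun y ↦ g * y) h (V h) := by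
  obtain ⟨-, φ, hφ, haut⟩ := hV
  have hvelocity (g : G) : HasVelocityAt (E := E) I (fun t ↦ φ t g) 0 (V g) :=
    (congrArg (fun x ↦ HasVelocityAt (E := E) I (fun t ↦ φ t g) 0 (V x)) (hφ g).1).mp ((hφ g).2 0)
  have hmul (t : ℝ) : φ t g * φ t h = φ t (g * h) := by
    obtain ⟨e, he, -⟩ := haut t
    simp only [← he, map_mul]
  have hproduct := (hvelocity g).mul (hvelocity h)
  simp only [hmul, (hφ g).1, (hφ h).1] at hproduct
  exact (hvelocity (g * h)).unique hproduct

theorem tderiv_mul_const_const_mul (g h : G) (v : E) :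
    tderiv I I (fun x ↦ x * (g * h)⁻¹) (g * h) (tderiv I I (fun y ↦ g * y) h v) =
      adjointRep I g (tderiv I I (fun x ↦ x * h⁻¹) h v) := by
  rw [adjointRep_apply, ← tderiv_comp_apply (mdifferentiableAt_mul_const _ _)
    (mdifferentiableAt_const_mul g h) rfl, ← tderiv_comp_apply (mdifferentiableAt_conj g 1)
    (mdifferentiableAt_mul_const _ _) (mul_inv_cancel h)]
  simp only [mul_inv_rev, mul_assoc]

theorem rightTranslate_mul (hV : IsLinearVectorField I V) (g h : G) :
    (rightTranslate V (g * h) : E) =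
      rightTranslate V g + adjointRep I g (rightTranslate V h) := by
  have hsum (v w : E) :
      tderiv I I (fun x ↦ x * (g * h)⁻¹) (g * h)
        (tderiv I I (fun y ↦ y * h) g v + tderiv I I (fun y ↦ g * y) h w) =
      tderiv I I (fun x ↦ x * g⁻¹) g v + adjointRep I g (tderiv I I (fun x ↦ x * h⁻¹) h w) := by
    rw [map_add, tderiv_mul_const_mul_const, tderiv_mul_const_const_mul, mul_inv_rev,
      mul_inv_cancel_left]
  exact (congrArg (tderiv (E := E) I I (fun x ↦ x * (g * h)⁻¹) (g * h))
    (hV.apply_mul g h)).trans (hsum (V g) (V h))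

theorem tderiv_mul_const_adjointRep (g : G) (v : E) :
    tderiv I I (fun x ↦ x * g) 1 (adjointRep I g v) = tderiv I I (fun x ↦ g * x) 1 v := by
  rw [adjointRep_apply, ← tderiv_comp_apply (mdifferentiableAt_mul_const g 1)
    (mdifferentiableAt_conj g 1) (by simp)]
  simp only [inv_mul_cancel_right]

theorem exists_eq_rightInvariantField_add_invPushforward [CompleteSpace E] [CompactSpace G]
    (hV : IsLinearVectorField I V) :
    ∃ X : GroupLieAlgebra I G, ∀ g : G,
      V g = rightInvariantField X g + invPushforward (rightInvariantField X) g := by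
  have : IsTopologicalGroup G := topologicalGroup_of_lieGroup I ∞
  obtain ⟨X, hX⟩ := exists_coboundary_of_cocycle (E := E) (adjointRep I)
    (continuous_rightTranslate hV.1) (rightTranslate_mul hV)
  have hconj (g : G) : tderiv (E := E) I I (fun x ↦ x * g) 1 (rightTranslate V g) =
      tderiv I I (fun a ↦ a * g * a⁻¹) 1 X := by
    rw [hX, map_sub, tderiv_mul_const_adjointRep, tderiv_conj_left]
  exact ⟨X, fun g ↦ (tderiv_mul_const_rightTranslate (E := E) g).symm.trans
    ((hconj g).trans (rightInvariantField_add_invPushforward X g).symm)⟩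

end LinearVectorFields

section PeriodicCurves

theorem IsPeriodicCurve.comp {M N : Type*} {γ : ℝ → M} (hγ : IsPeriodicCurve γ) (f : M → N) :
    IsPeriodicCurve fun t ↦ f (γ t) := by
  obtain ⟨s, hs, h⟩ := hγ
  exact ⟨s, hs, fun t ↦ congrArg f (h t)⟩

theorem isPeriodicCurve_iff_exists_eq_one {A : Type*} [Monoid A] {a : ℝ → A} (h0 : a 0 = 1)
    (hadd : ∀ s t, a (s + t) = a s * a t) : IsPeriodicCurve a ↔ ∃ s > 0, a s = 1 := by
  constructor <;> rintro ⟨s, hs, h⟩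
  · exact ⟨s, hs, by simpa [h0] using h 0⟩
  · exact ⟨s, hs, fun t ↦ by rw [hadd, h, mul_one]⟩

theorem isPeriodicCurve_of_finite_ker {A G : Type*} [Monoid A] [Group G] {ρ : G →* A}
    [Finite ρ.ker] {γ : ℝ → G} (h0 : γ 0 = 1) (hadd : ∀ s t, γ (s + t) = γ s * γ t)
    (h : IsPeriodicCurve fun t ↦ ρ (γ t)) : IsPeriodicCurve γ := by
  obtain ⟨s, hs, hker⟩ := (isPeriodicCurve_iff_exists_eq_one (by rw [h0, map_one])
    fun s t ↦ by rw [hadd, map_mul]).1 h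
  obtain ⟨n, hn, hpow⟩ := (isOfFinOrder_of_finite
    (⟨γ s, MonoidHom.mem_ker.2 hker⟩ : ρ.ker)).exists_pow_eq_one
  have hmul (n : ℕ) : γ (n * s) = γ s ^ n := by
    induction n with
    | zero => simp [h0]
    | succ n ih => rw [Nat.cast_succ, add_mul, one_mul, hadd, ih, pow_succ]
  exact (isPeriodicCurve_iff_exists_eq_one h0 hadd).2
    ⟨n * s, by positivity, (hmul n).trans (congrArg Subtype.val hpow)⟩

theorem eq_zero_of_forall_lie_eq_zero {R L : Type*} [CommRing R] [LieRing L] [LieAlgebra R L]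
    [LieAlgebra.HasTrivialRadical R L] {Z : L} (hZ : ∀ Y : L, ⁅Z, Y⁆ = 0) : Z = 0 := by
  have hmem : Z ∈ LieAlgebra.center R L :=
    (LieModule.mem_maxTrivSubmodule R L L Z).2 fun Y ↦ by rw [← lie_skew, hZ, neg_zero]
  rwa [LieAlgebra.center_eq_bot, LieSubmodule.mem_bot] at hmem

variable {E : Type*} [NormedAddCommGroup E] [NormedSpace ℝ E] [FiniteDimensional ℝ E]
  [CompleteSpace E] {H : Type*} [TopologicalSpace H] {I : ModelWithCorners ℝ E H} [I.Boundaryless]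
  {G : Type*} [TopologicalSpace G] [ChartedSpace H G] [Group G] [LieGroup I ∞ G] [T2Space G]
  {V : ∀ g : G, TangentSpace I g} {X : GroupLieAlgebra I G}

theorem forall_isPeriodicCurve_expFlow_comp_Ad_iff {γ : ℝ → G} (h0 : γ 0 = 1)
    (hγ : IsMIntegralCurve (I := I) γ (rightInvariantField X))
    (hVX : ∀ g, V g = rightInvariantField X g + invPushforward (rightInvariantField X) g) :
    (∀ g : G, IsPeriodicCurve fun t ↦ (expFlow (derivationOf V) t).comp (Ad g)) ↔
      IsPeriodicCurve fun t ↦ adjointRep I (γ t) := by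
  have hflow (g : G) : (fun t ↦ (expFlow (derivationOf V) t).comp (Ad g)) =
      fun t ↦ adjointRep I (γ t) * adjointRep I g :=
    funext fun t ↦ congrArg (· * adjointRep I g) (expFlow_eq_adjointRep h0 hγ hVX t)
  refine ⟨fun h ↦ ?_, fun h g ↦ hflow g ▸ h.comp (· * adjointRep I g)⟩
  have hone := hflow 1 ▸ h 1
  simp only [map_one, mul_one] at hone
  exact hone

theorem tfae_isPeriodicCurve [ConnectedSpace G] [BaireSpace G] [Finite (adjointRep I (G := G)).ker]
    (hcenter : ∀ Z : GroupLieAlgebra I G, (∀ Y : GroupLieAlgebra I G, ⁅Z, Y⁆ = 0) → Z = 0)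
    (hV : IsSmoothField I V) {φ : ℝ → G → G} (hφ : IsFlowOf I φ V)
    (hVX : ∀ g, V g = rightInvariantField X g + invPushforward (rightInvariantField X) g) :
    List.TFAE [
      ∀ g : G, IsPeriodicCurve fun t : ℝ ↦ lieExp (t • X) * g,
      IsPeriodicCurve fun t : ℝ ↦ lieExp (t • X) * (1 : G),
      ∀ g : G, IsPeriodicCurve fun t : ℝ ↦ φ t g,
      ∀ g : G, IsPeriodicCurve fun t : ℝ ↦ (expFlow (derivationOf V) t).comp (Ad g)] := by
  obtain ⟨γ, h0, hγ⟩ := exists_isMIntegralCurve_rightInvariantField X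
  have hadd := integralCurve_add h0 hγ
  simp only [lieExp_smul h0 hγ, flow_eq_conj h0 hγ hV hVX hφ,
    forall_isPeriodicCurve_expFlow_comp_Ad_iff h0 hγ hVX, mul_one]
  tfae_have 1 → 2 := fun h ↦ by simpa only [mul_one] using h 1
  tfae_have 2 → 1 := fun h g ↦ h.comp (· * g)
  tfae_have 2 → 3 := fun h g ↦ h.comp fun a ↦ a * g * a⁻¹
  tfae_have 3 → 4 := fun h ↦ by
    refine (isPeriodicCurve_iff_exists_eq_one (by rw [h0, map_one]) fun s t ↦ by
      rw [hadd, map_mul]).2 (exists_adjointRep_eq_one hcenter h0 hγ fun g ↦ ?_)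
    obtain ⟨s, hs, hperiod⟩ := h g
    exact ⟨s, hs, mul_inv_eq_iff_eq_mul.1 (by simpa [h0] using hperiod 0)⟩
  tfae_have 4 → 2 := isPeriodicCurve_of_finite_ker h0 hadd
  tfae_finish

end PeriodicCurves

end LinearFlow

theorem mainTheorem10
    {E : Type*} [NormedAddCommGroup E] [NormedSpace ℝ E] [FiniteDimensional ℝ E] [CompleteSpace E]
    {H : Type*} [TopologicalSpace H] (I : ModelWithCorners ℝ E H) [I.Boundaryless]
    (G : Type*) [TopologicalSpace G] [ChartedSpace H G] [Group G] [LieGroup I ∞ G]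
    [T2Space G] [ConnectedSpace G] [CompactSpace G]
    [LieAlgebra.IsSemisimple ℝ (GroupLieAlgebra I G)]
    (𝒳 : ∀ g : G, TangentSpace I g) (h𝒳 : LinearFlow.IsLinearVectorField I 𝒳)
    (φ : ℝ → G → G) (hφ : LinearFlow.IsFlowOf I φ 𝒳) :
    (∃ X : GroupLieAlgebra I G, ∀ g : G,
      𝒳 g = LinearFlow.rightInvariantField X g +
        LinearFlow.invPushforward (LinearFlow.rightInvariantField X) g) ∧
    ∀ X : GroupLieAlgebra I G,
      (∀ g : G, 𝒳 g = LinearFlow.rightInvariantField X g +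
        LinearFlow.invPushforward (LinearFlow.rightInvariantField X) g) →
      List.TFAE [
        ∀ g : G, LinearFlow.IsPeriodicCurve (fun t : ℝ ↦ LinearFlow.lieExp (t • X) * g),
        LinearFlow.IsPeriodicCurve (fun t : ℝ ↦ LinearFlow.lieExp (t • X) * (1 : G)),
        ∀ g : G, LinearFlow.IsPeriodicCurve (fun t : ℝ ↦ φ t g),
        ∀ g : G, LinearFlow.IsPeriodicCurve (fun t : ℝ ↦
          (LinearFlow.expFlow (LinearFlow.derivationOf 𝒳) t).comp (LinearFlow.Ad g))] := by
  have hcenter (Z : GroupLieAlgebra I G) (hZ : ∀ Y : GroupLieAlgebra I G, ⁅Z, Y⁆ = 0) : Z = 0 :=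
    LinearFlow.eq_zero_of_forall_lie_eq_zero (R := ℝ) hZ
  have := LinearFlow.finite_ker_adjointRep (I := I) (G := G) hcenter
  exact ⟨LinearFlow.exists_eq_rightInvariantField_add_invPushforward h𝒳, fun X hX ↦
    LinearFlow.tfae_isPeriodicCurve hcenter h𝒳.1 hφ hX⟩
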